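/- Let $(X,\mathscr A,\mu)$ be a $\sigma$-finite measure space, $\phi\colon X\to X$ and $w\colon X\to\mathbb C$ be $\mathscr A$-measurable, and for measurable $v\colon X\to\mathbb C$ put $\mu_v(\sigma)=\int_\sigma|v|^2\,d\mu$. If $\mu_v\circ\phi^{-1}\ll\mu$, we say that $C_{\phi,v}$ is well defined; then $C_{\phi,v}$ is the operator in $L^2(\mu)=L^2(\mu;\mathbb C)$ given by $C_{\phi,v}f=v\cdot(f\circ\phi)$ on $\{f\in L^2(\mu)\colon v\cdot(f\circ\phi)\in L^2(\mu)\}$, and $\mathsf h_{\phi,v}=d(\mu_v\circ\phi^{-1})/d\mu\colon X\to[0,\infty]$. Write $C_\phi=C_{\phi,\mathbf 1}$, $\mathsf h_\phi=\mathsf h_{\phi,\mathbf 1}$, let $M_w$ be the operator of multiplication by $w$ with domain $\{f\in L^2(\mu)\colon wf\in L^2(\mu)\}$, and let $\mathsf E_\phi(f)$ be the conditional expectation of $f\colon X\to[0,\infty]$ with respect to $\phi^{-1}(\mathscr A)$ and $\mu$. Products of operators have their natural domains. For an operator $T$ in a Hilbert space with domain $D(T)$, kernel $N(T)$ and range $R(T)$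 satisfying $D(T)=N(T)\oplus(D(T)\cap N(T)^\perp)$, the reciprocal $T^\dag$ of $T$ is the unique operator with $D(T^\dag)=R(T)\oplus R(T)^\perp$, $N(T^\dag)=R(T)^\perp$, $TT^\dag f=P_{\overline{R(T)}}f$ for $f\in D(T^\dag)$ and $T^\dag Tg=P_{N(T)^\perp}g$ for $g\in D(T)$. Assume that $C_{\phi,w}$ is well defined and densely defined in $L^2(\mu)$ and that $|w|>\alpha$ a.e. $[\mu]$ for some real $\alpha>0$. Then $C_\phi$ is well defined and densely defined, $C_{\phi,w}=M_wC_\phi$, and the reciprocals of $M_wC_\phi$, $C_\phi$ and $M_w$ exist. Moreover, $(M_wC_\phi)^\dag=C_\phi^\dag M_w^\dag$ if and only if the following two conditions hold: (i) there is a real $\beta>0$ such that $\mathsf h_{\phi,\hat w}\le\beta\,\mathsf h_{\phi,\hat{\mathbf 1}}$ a.e. $[\mu]$, where $\hat w=\dfrac{w}{\mathsf h_{\phi,w}\circ\phi}$ and $\hat{\mathbf 1}=\dfrac{1}{\mathsf h_\phi\circ\phi}$; (ii) $|w|^2=\mathsf E_\phi(|w|^2)$ a.e. $[\mu]$. -/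

import Mathlib

open MeasureTheory
open scoped ENNReal

noncomputable section

/-! ### Unbounded operators in a Hilbert space -/

namespace PartialOp

variable {H : Type*} [NormedAddCommGroup H] [InnerProductSpace ℂ H]

/-- The kernel of a partially defined operator, as a subspace of the whole space. -/
def ker (T : H →ₗ.[ℂ] H) : Submodule ℂ H :=
  (LinearMap.ker T.toFun).map T.domain.subtype

/-- The range of a partially defined operator. -/
def range (T : H →ₗ.[ℂ] H) : Submodule ℂ H :=
  LinearMap.range T.toFun

/-- The subspace `{x ∈ D(T) : T x ∈ D(S)}`. -/
def mulDomain (S T : H →ₗ.[ℂ] H) : Submodule ℂ H :=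
  (S.domain.comap T.toFun).map T.domain.subtype

/-- The product `S T` of two partially defined operators, with its natural domain
`{x ∈ D(T) : T x ∈ D(S)}`. -/
def mul (S T : H →ₗ.[ℂ] H) : H →ₗ.[ℂ] H :=
  S.comp (T.domRestrict (mulDomain S T)) (by
    rintro ⟨x, hx, hx'⟩
    obtain ⟨y, hy, hyx⟩ := hx
    have h : y = ⟨x, hx'⟩ := Subtype.ext hyx
    subst h
    exact hy)

/-- The condition `D(T) = N(T) ⊕ (D(T) ∩ N(T)ᗮ)` under which the reciprocal of `T` exists
(the sum is automatically orthogonal). -/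
def HasReciprocal (T : H →ₗ.[ℂ] H) : Prop :=
  T.domain = ker T ⊔ (T.domain ⊓ (ker T)ᗮ)

/-- The graph of the reciprocal: the pairs `(T g + k, g)` with `g ∈ D(T) ∩ N(T)ᗮ` and
`k ∈ R(T)ᗮ`. -/
def reciprocalGraph (T : H →ₗ.[ℂ] H) : Submodule ℂ (H × H) where
  carrier := {p | ∃ g : T.domain, (g : H) ∈ (ker T)ᗮ ∧ p.2 = g ∧ p.1 - T g ∈ (range T)ᗮ}
  add_mem' := by
    rintro ⟨a, b⟩ ⟨c, d⟩ ⟨g, hg, hb, ha⟩ ⟨k, hk, hd, hc⟩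
    refine ⟨g + k, ?_, ?_, ?_⟩
    · exact add_mem hg hk
    · simp only at hb hd
      simp [hb, hd]
    · have := add_mem ha hc
      simp only [Prod.mk_add_mk, LinearPMap.map_add] at this ⊢
      convert this using 1
      abel
  zero_mem' := ⟨0, by simp, by simp, by simp⟩
  smul_mem' := by
    rintro c ⟨a, b⟩ ⟨g, hg, hb, ha⟩
    refine ⟨c • g, ?_, ?_, ?_⟩
    · exact Submodule.smul_mem _ c hg
    · simp only at hb
      simp [hb]
    · have := Submodule.smul_mem _ c ha
      simp only [Prod.smul_mk, LinearPMap.map_smul] at this ⊢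
      rwa [← smul_sub]

/-- The reciprocal `T†` of `T`: the operator whose graph is `reciprocalGraph T`. -/
def reciprocal (T : H →ₗ.[ℂ] H) : H →ₗ.[ℂ] H :=
  (reciprocalGraph T).toLinearPMap

lemma reciprocalGraph_single (T : H →ₗ.[ℂ] H) (p : H × H) (hp : p ∈ reciprocalGraph T)
    (h0 : p.1 = 0) : p.2 = 0 := by
  obtain ⟨g, hg, h2, h1⟩ := hp
  rw [h0, zero_sub, Submodule.neg_mem_iff] at h1
  have hT : T g = 0 := by
    have hr : T g ∈ range T := ⟨g, rfl⟩
    exact inner_self_eq_zero.1 (h1 (T g) hr)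
  have hk : (g : H) ∈ ker T := ⟨g, hT, rfl⟩
  rw [h2]
  exact inner_self_eq_zero.1 (hg (g : H) hk)

lemma reciprocal_graph (T : H →ₗ.[ℂ] H) : (reciprocal T).graph = reciprocalGraph T :=
  Submodule.toLinearPMap_graph_eq _ (reciprocalGraph_single T)

/-- The defining properties of the reciprocal `S = T†` of `T`: `D(S) = R(T) ⊕ R(T)ᗮ`,
`T S f = P f` with `P` the orthogonal projection onto the closure of `R(T)`, `S T g = Q g` with `Q`
the orthogonal projection onto `N(T)ᗮ`, and `N(S) = R(T)ᗮ`. -/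
structure IsReciprocal [CompleteSpace H] (T S : H →ₗ.[ℂ] H) : Prop where
  domain_eq : S.domain = range T ⊔ (range T)ᗮ
  mul_left : ∀ f : S.domain, ∃ h : S f ∈ T.domain,
    T ⟨S f, h⟩ = (range T).topologicalClosure.starProjection (f : H)
  mul_right : ∀ g : T.domain, ∃ h : T g ∈ S.domain,
    S ⟨T g, h⟩ = (ker T)ᗮ.starProjection (g : H)
  ker_eq : ker S = (range T)ᗮ

/-- Whenever `D(T) = N(T) ⊕ (D(T) ∩ N(T)ᗮ)`, the operator `reciprocal T` has the defining properties
of the reciprocal. -/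
theorem isReciprocal_reciprocal [CompleteSpace H] (T : H →ₗ.[ℂ] H) (hT : HasReciprocal T) :
    IsReciprocal T (reciprocal T) := by
  have key : ∀ f y : H, (∃ h : f ∈ (reciprocal T).domain, reciprocal T ⟨f, h⟩ = y) ↔
      (f, y) ∈ reciprocalGraph T := by
    intro f y
    rw [← reciprocal_graph, LinearPMap.mem_graph_iff]
    constructor
    · rintro ⟨h, rfl⟩
      exact ⟨⟨f, h⟩, rfl, rfl⟩
    · rintro ⟨⟨z, hz⟩, h1, h2⟩
      simp only at h1 h2
      subst h1
      exact ⟨hz, h2⟩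
  have dec : ∀ g : T.domain, ∃ k : T.domain, (k : H) ∈ (ker T)ᗮ ∧ T k = T g ∧
      (g : H) - k ∈ ker T := by
    intro g
    have hg : (g : H) ∈ ker T ⊔ (T.domain ⊓ (ker T)ᗮ) := hT ▸ g.2
    obtain ⟨n, hn, k, hk, hnk⟩ := Submodule.mem_sup.1 hg
    have hgk : (g : H) - k = n := by rw [← hnk]; abel
    refine ⟨⟨k, hk.1⟩, hk.2, ?_, by rw [hgk]; exact hn⟩
    obtain ⟨n', hn', rfl⟩ := hn
    have : g = n' + ⟨k, hk.1⟩ := Subtype.ext hnk.symm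
    rw [this, LinearPMap.map_add]
    have h0 : T n' = 0 := hn'
    rw [h0, zero_add]
  refine ⟨?_, ?_, ?_, ?_⟩
  · ext f
    constructor
    · intro hf
      obtain ⟨g, -, -, h⟩ := (key f _).1 ⟨hf, rfl⟩
      have : f = T g + (f - T g) := by abel
      rw [this]
      exact Submodule.add_mem_sup ⟨g, rfl⟩ h
    · intro hf
      obtain ⟨a, ⟨g, rfl⟩, b, hb, rfl⟩ := Submodule.mem_sup.1 hf
      obtain ⟨k, hk, hTk, -⟩ := dec g
      refine ((key _ (k : H)).2 ⟨k, hk, rfl, ?_⟩).1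
      have : T.toFun g + b - T k = b := by rw [hTk]; exact add_sub_cancel_left _ _
      rw [this]
      exact hb
  · intro f
    obtain ⟨g, -, h2, h⟩ := (key f _).1 ⟨f.2, rfl⟩
    simp only at h2 h
    have h2' : reciprocal T f = g := h2
    refine ⟨by rw [h2']; exact g.2, ?_⟩
    have : (⟨reciprocal T f, by rw [h2']; exact g.2⟩ : T.domain) = g := Subtype.ext h2'
    rw [this]
    symm
    apply Submodule.eq_starProjection_of_mem_of_inner_eq_zero
    · exact Submodule.le_topologicalClosure _ ⟨g, rfl⟩
    · rw [← Submodule.mem_orthogonal', Submodule.orthogonal_closure]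
      exact h
  · intro g
    obtain ⟨k, hk, hTk, hgk⟩ := dec g
    have hm : (T g, (k : H)) ∈ reciprocalGraph T := by
      refine ⟨k, hk, rfl, ?_⟩
      simp [hTk]
    obtain ⟨h, hh⟩ := (key _ _).2 hm
    refine ⟨h, ?_⟩
    rw [hh]
    symm
    apply Submodule.eq_starProjection_of_mem_of_inner_eq_zero hk
    intro v hv
    exact hv _ hgk
  · ext f
    constructor
    · rintro ⟨f', hf', rfl⟩
      obtain ⟨g, -, h2, h⟩ := (key f' 0).1 ⟨f'.2, hf'⟩
      have : g = 0 := Subtype.ext h2.symm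
      subst this
      simpa using h
    · intro hf
      obtain ⟨h, hh⟩ := (key f 0).2 ⟨0, by simp, by simp, by simpa using hf⟩
      exact ⟨⟨f, h⟩, hh, rfl⟩

/-- The defining properties determine the reciprocal. -/
theorem IsReciprocal.unique [CompleteSpace H] {T S S' : H →ₗ.[ℂ] H} (h : IsReciprocal T S)
    (h' : IsReciprocal T S') : S = S' := by
  have hd : S.domain = S'.domain := h.domain_eq.trans h'.domain_eq.symm
  refine LinearPMap.ext hd ?_
  intro f hf hf'
  have hfm : f ∈ range T ⊔ (range T)ᗮ := h.domain_eq ▸ hf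
  obtain ⟨a, ⟨g, rfl⟩, b, hb, rfl⟩ := Submodule.mem_sup.1 hfm
  have aux : ∀ {R : H →ₗ.[ℂ] H}, IsReciprocal T R → ∀ hR : T.toFun g + b ∈ R.domain,
      R ⟨T.toFun g + b, hR⟩ = (ker T)ᗮ.starProjection (g : H) := by
    intro R hR hm
    obtain ⟨hg, e⟩ := hR.mul_right g
    have hbk : b ∈ ker R := hR.ker_eq ▸ hb
    obtain ⟨b', hb', rfl⟩ := hbk
    have h0 : R b' = 0 := hb'
    have : (⟨T.toFun g + (b' : H), hm⟩ : R.domain) = ⟨T g, hg⟩ + b' := Subtype.ext rfl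
    calc R ⟨T.toFun g + (b' : H), hm⟩ = R (⟨T g, hg⟩ + b') := congrArg R this
      _ = _ := by rw [LinearPMap.map_add, h0, add_zero, e]
  exact (aux h hf).trans (aux h' hf').symm

end PartialOp

/-! ### Weighted composition operators -/

namespace WeightedComp

variable {X : Type*} [MeasurableSpace X]

/-- The measure `μ_w`, `μ_w(σ) = ∫_σ |w|² dμ`. -/
def weightedMeasure (μ : Measure X) (w : X → ℂ) : Measure X :=
  μ.withDensity fun x => ‖w x‖ₑ ^ 2

/-- The weighted composition operator `C_{φ,w}` is well defined: `μ_w ∘ φ⁻¹` is absolutely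
continuous with respect to `μ`. -/
def WellDefined (μ : Measure X) (φ : X → X) (w : X → ℂ) : Prop :=
  (weightedMeasure μ w).map φ ≪ μ

lemma WellDefined.ae {μ : Measure X} {φ : X → X} {w : X → ℂ} (hφ : Measurable φ)
    (hw : Measurable w) (h : WellDefined μ φ w) {p : X → Prop} (hp : ∀ᵐ x ∂μ, p x) :
    ∀ᵐ x ∂μ, w x ≠ 0 → p (φ x) := by
  have h1 : ∀ᵐ x ∂weightedMeasure μ w, p (φ x) := ae_of_ae_map hφ.aemeasurable (h.ae_le hp)
  rw [weightedMeasure, ae_withDensity_iff (by fun_prop)] at h1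
  filter_upwards [h1] with x hx hwx
  exact hx (by simpa using hwx)

lemma WellDefined.mul_add_ae {μ : Measure X} {φ : X → X} {w : X → ℂ} (hφ : Measurable φ)
    (hw : Measurable w) (h : WellDefined μ φ w) (f g : Lp ℂ 2 μ) :
    (fun x => w x * (f + g) (φ x)) =ᵐ[μ] (fun x => w x * f (φ x)) + fun x => w x * g (φ x) := by
  filter_upwards [h.ae hφ hw (Lp.coeFn_add f g)] with x hx
  by_cases hwx : w x = 0
  · simp [hwx]
  · simp only [hx hwx, Pi.add_apply, mul_add]

lemma WellDefined.mul_smul_ae {μ : Measure X} {φ : X → X} {w : X → ℂ} (hφ : Measurable φ)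
    (hw : Measurable w) (h : WellDefined μ φ w) (c : ℂ) (f : Lp ℂ 2 μ) :
    (fun x => w x * (c • f) (φ x)) =ᵐ[μ] c • fun x => w x * f (φ x) := by
  filter_upwards [h.ae hφ hw (Lp.coeFn_smul c f)] with x hx
  by_cases hwx : w x = 0
  · simp [hwx]
  · simp only [hx hwx, Pi.smul_apply, smul_eq_mul]
    ring

/-- The domain `{f ∈ L²(μ) : w · (f ∘ φ) ∈ L²(μ)}` of `C_{φ,w}`. -/
def opDomain (μ : Measure X) (φ : X → X) (w : X → ℂ) (hφ : Measurable φ) (hw : Measurable w)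
    (h : WellDefined μ φ w) : Submodule ℂ (Lp ℂ 2 μ) where
  carrier := {f | MemLp (fun x => w x * f (φ x)) 2 μ}
  add_mem' := fun {f g} hf hg =>
    (memLp_congr_ae (h.mul_add_ae hφ hw f g)).2 (MemLp.add hf hg)
  zero_mem' := by
    have : (fun x => w x * (0 : Lp ℂ 2 μ) (φ x)) =ᵐ[μ] 0 := by
      filter_upwards [h.ae hφ hw (Lp.coeFn_zero ℂ 2 μ)] with x hx
      by_cases hwx : w x = 0
      · simp [hwx]
      · rw [hx hwx]
        simp
    exact (memLp_congr_ae this).2 MemLp.zero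
  smul_mem' := fun c f hf =>
    (memLp_congr_ae (h.mul_smul_ae hφ hw c f)).2 (MemLp.const_smul hf c)

/-- The weighted composition operator `C_{φ,w} f = w · (f ∘ φ)` in `L²(μ)`. -/
def op (μ : Measure X) (φ : X → X) (w : X → ℂ) (hφ : Measurable φ) (hw : Measurable w)
    (h : WellDefined μ φ w) : Lp ℂ 2 μ →ₗ.[ℂ] Lp ℂ 2 μ where
  domain := opDomain μ φ w hφ hw h
  toFun :=
    { toFun := fun f => MemLp.toLp (fun x => w x * (f : Lp ℂ 2 μ) (φ x)) f.2
      map_add' := fun f g => by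
        rw [← MemLp.toLp_add f.2 g.2]
        exact MemLp.toLp_congr _ _ (h.mul_add_ae hφ hw f g)
      map_smul' := fun c f => by
        rw [RingHom.id_apply, ← MemLp.toLp_const_smul c f.2]
        exact MemLp.toLp_congr _ _ (h.mul_smul_ae hφ hw c f) }

lemma wellDefined_id (μ : Measure X) (w : X → ℂ) : WellDefined μ id w := by
  rw [WellDefined, Measure.map_id]
  exact withDensity_absolutelyContinuous _ _

/-- The operator `M_w` of multiplication by `w` in `L²(μ)`, with domain
`{f ∈ L²(μ) : w · f ∈ L²(μ)}`. -/
def mulOp (μ : Measure X) (w : X → ℂ) (hw : Measurable w) : Lp ℂ 2 μ →ₗ.[ℂ] Lp ℂ 2 μ :=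
  op μ id w measurable_id hw (wellDefined_id μ w)

/-- The composition operator `C_φ = C_{φ,𝟏}` in `L²(μ)`. -/
def compOp (μ : Measure X) (φ : X → X) (hφ : Measurable φ) (h : WellDefined μ φ 1) :
    Lp ℂ 2 μ →ₗ.[ℂ] Lp ℂ 2 μ :=
  op μ φ 1 hφ measurable_one h

/-- The Radon-Nikodym derivative `h_{φ,w}` of `μ_w ∘ φ⁻¹` with respect to `μ`. -/
def rn (μ : Measure X) (φ : X → X) (w : X → ℂ) : X → ℝ≥0∞ :=
  ((weightedMeasure μ w).map φ).rnDeriv μ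

/-- The weight `ŵ = w / (h_{φ,w} ∘ φ)`. -/
def hat (μ : Measure X) (φ : X → X) (w : X → ℂ) : X → ℂ :=
  fun x => w x / ((rn μ φ w (φ x)).toReal : ℂ)

/-- The conditional expectation `E_φ(f)` of a nonnegative function `f` with respect to the
σ-algebra `φ⁻¹(𝒜)` and the measure `μ`. -/
def condE {mX : MeasurableSpace X} (μ : Measure X) (φ : X → X) (f : X → ℝ≥0∞) : X → ℝ≥0∞ :=
  condLExp (mX.comap φ) μ f

end WeightedComp

end

/-! ### Graphs of products and reciprocals. -/

namespace PartialOp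

variable {H : Type*} [NormedAddCommGroup H] [InnerProductSpace ℂ H]

/-! Since `|w| > α`, `M_w†` is division by `w`, defined everywhere, and `C_{φ,w}` and `C_φ` have the
same kernel. Hence `(f, g)` lies in the graph of `C_{φ,w}†` when `f - w·(g∘φ) ⊥ R(C_{φ,w})`, and in
that of `C_φ† M_w†` when `f/w - g∘φ ⊥ R(C_φ)`, with the same requirement `g ⊥ N(C_φ)`. Condition (i)
is automatic with `β = α⁻²` (`rn_hat_le`), so the question is whether division by `w` matches the
two orthogonal complements exactly when (ii) holds.

If (ii) holds, then `|w|² = u∘φ` and `⟨w·(q∘φ), w·z⟩ = ⟨(uq)∘φ, z⟩`, which carries orthogonality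
both ways. As `u` may be unbounded, one direction needs truncation to `{u ≤ n²}`, also used to show
`w·(g∘φ) ∈ L²` (`memLp_of_mul_sub_mem`, `reciprocal_op_eq_of_factor`).

Conversely, the pairs `(k, 0)` show that `k ⊥ R(C_{φ,w})` forces `k/w ⊥ R(C_φ)`. By duality
`(f∘φ)/w̄` lies in the closure of `R(C_{φ,w})`, whose elements have the form `w·(t∘φ)`. For `f > 0`
this makes `|w|²` a function of `φ`, which is (ii) (`eq_condE_of_reciprocal_op_eq`). -/

lemma mem_ker_iff {T : H →ₗ.[ℂ] H} {f : H} : f ∈ ker T ↔ (f, (0 : H)) ∈ T.graph := by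
  rw [LinearPMap.mem_graph_iff]
  constructor
  · rintro ⟨g, hg, rfl⟩
    exact ⟨g, rfl, hg⟩
  · rintro ⟨g, h1, h2⟩
    exact ⟨g, h2, h1⟩

lemma mem_range_iff {T : H →ₗ.[ℂ] H} {y : H} : y ∈ range T ↔ ∃ f, (f, y) ∈ T.graph := by
  constructor
  · rintro ⟨g, rfl⟩
    exact ⟨g, T.mem_graph g⟩
  · rintro ⟨f, hf⟩
    obtain ⟨g, -, h⟩ := T.mem_graph_iff.1 hf
    exact ⟨g, h⟩

lemma mem_domain_iff {T : H →ₗ.[ℂ] H} {f : H} : f ∈ T.domain ↔ ∃ y, (f, y) ∈ T.graph := by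
  constructor
  · intro hf
    exact ⟨T ⟨f, hf⟩, T.mem_graph ⟨f, hf⟩⟩
  · rintro ⟨y, hy⟩
    obtain ⟨g, h, -⟩ := T.mem_graph_iff.1 hy
    simp only at h
    exact h ▸ g.2

lemma mem_graph_mul_iff {S T : H →ₗ.[ℂ] H} {f g : H} :
    (f, g) ∈ (mul S T).graph ↔ ∃ y, (f, y) ∈ T.graph ∧ (y, g) ∈ S.graph := by
  constructor
  · intro h
    obtain ⟨⟨x, hx, hx'⟩, rfl, h2⟩ := (LinearPMap.mem_graph_iff _).1 h
    refine ⟨T ⟨x, hx'⟩, T.mem_graph ⟨x, hx'⟩, ?_⟩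
    simp only at h2
    rw [← h2]
    exact S.mem_graph ⟨T ⟨x, hx'⟩, _⟩
  · rintro ⟨y, h1, h2⟩
    obtain ⟨x, rfl, rfl⟩ := T.mem_graph_iff.1 h1
    obtain ⟨z, hz, rfl⟩ := S.mem_graph_iff.1 h2
    simp only at hz
    refine (LinearPMap.mem_graph_iff _).2 ⟨⟨x, ⟨x, ?_, rfl⟩, x.2⟩, rfl, ?_⟩
    · change T x ∈ S.domain
      exact hz ▸ z.2
    · change S ⟨T x, _⟩ = S z
      congr 1
      exact Subtype.ext hz.symm

lemma mem_graph_reciprocal_iff {T : H →ₗ.[ℂ] H} {f g : H} :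
    (f, g) ∈ (reciprocal T).graph ↔
      ∃ y, (g, y) ∈ T.graph ∧ g ∈ (ker T)ᗮ ∧ f - y ∈ (range T)ᗮ := by
  rw [reciprocal_graph]
  constructor
  · rintro ⟨x, h1, h2, h3⟩
    simp only at h2
    subst h2
    exact ⟨T x, T.mem_graph x, h1, h3⟩
  · rintro ⟨y, h1, h2, h3⟩
    obtain ⟨x, rfl, rfl⟩ := T.mem_graph_iff.1 h1
    exact ⟨x, h2, rfl, h3⟩

end PartialOp

/-! ### Change of variables, kernels and domains in `L²`. -/

namespace WeightedComp

variable {X : Type*} [MeasurableSpace X] {μ : Measure X} {φ : X → X} {w : X → ℂ}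

lemma mem_graph_op_iff (hφ : Measurable φ) (hw : Measurable w) (h : WellDefined μ φ w)
    {f g : Lp ℂ 2 μ} :
    (f, g) ∈ (op μ φ w hφ hw h).graph ↔ g =ᵐ[μ] fun x => w x * f (φ x) := by
  rw [LinearPMap.mem_graph_iff]
  constructor
  · rintro ⟨x, rfl, rfl⟩
    exact MemLp.coeFn_toLp x.2
  · intro hg
    refine ⟨⟨f, (memLp_congr_ae hg).1 (Lp.memLp g)⟩, rfl, ?_⟩
    exact Lp.ext ((MemLp.coeFn_toLp ((memLp_congr_ae hg).1 (Lp.memLp g))).trans hg.symm)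

/-- A measurable function dominated by a multiple of an `L²` function is in `L²`. -/
lemma exists_coeFn_ae_eq (f : Lp ℂ 2 μ) {g : X → ℂ} (hg : AEStronglyMeasurable g μ) (c : ℝ)
    (h : ∀ᵐ x ∂μ, ‖g x‖ ≤ c * ‖f x‖) : ∃ g' : Lp ℂ 2 μ, g' =ᵐ[μ] g :=
  ⟨_, MemLp.coeFn_toLp ((Lp.memLp f).of_le_mul hg h)⟩

lemma inner_congr {a b c d : Lp ℂ 2 μ}
    (h : ∀ᵐ x ∂μ, inner ℂ (a x) (b x) = inner ℂ (c x) (d x)) : inner ℂ a b = inner ℂ c d := by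
  rw [L2.inner_def, L2.inner_def]
  exact integral_congr_ae h

lemma memLp_two_iff_lintegral {f : X → ℂ} (hf : AEStronglyMeasurable f μ) :
    MemLp f 2 μ ↔ ∫⁻ x, ‖f x‖ₑ ^ 2 ∂μ < ∞ := by
  have : eLpNorm f 2 μ < ∞ ↔ _ :=
    eLpNorm_lt_top_iff_lintegral_rpow_enorm_lt_top two_ne_zero ENNReal.ofNat_ne_top
  simp only [ENNReal.toReal_ofNat, ENNReal.rpow_ofNat] at this
  rw [← this]
  exact ⟨fun h => h.2, fun h => ⟨hf, h⟩⟩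

lemma measurable_rn : Measurable (rn μ φ w) := Measure.measurable_rnDeriv _ _

variable [SigmaFinite μ]

instance : SFinite (weightedMeasure μ w) := by
  unfold weightedMeasure
  infer_instance

lemma withDensity_rn (h : WellDefined μ φ w) :
    μ.withDensity (rn μ φ w) = (weightedMeasure μ w).map φ :=
  Measure.withDensity_rnDeriv_eq _ _ h

/-- Both sides integrate `F` against `μ_w ∘ φ⁻¹`. -/
lemma lintegral_weight_mul_comp (hφ : Measurable φ) (hw : Measurable w) (h : WellDefined μ φ w)
    {F : X → ℝ≥0∞} (hF : Measurable F) :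
    ∫⁻ x, ‖w x‖ₑ ^ 2 * F (φ x) ∂μ = ∫⁻ x, rn μ φ w x * F x ∂μ := by
  have h1 := lintegral_withDensity_eq_lintegral_mul μ (measurable_rn (μ := μ) (φ := φ) (w := w)) hF
  have h2 := lintegral_withDensity_eq_lintegral_mul μ (f := fun x => ‖w x‖ₑ ^ 2) (by fun_prop)
    (hF.comp hφ)
  rw [withDensity_rn h, lintegral_map hF hφ] at h1
  exact h2.symm.trans h1

lemma memLp_iff_lintegral_rn (hφ : Measurable φ) (hw : Measurable w) (h : WellDefined μ φ w)
    (f : Lp ℂ 2 μ) :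
    MemLp (fun x => w x * f (φ x)) 2 μ ↔ ∫⁻ x, rn μ φ w x * ‖f x‖ₑ ^ 2 ∂μ < ∞ := by
  have hf : Measurable f := (Lp.stronglyMeasurable f).measurable
  rw [memLp_two_iff_lintegral (by fun_prop),
    ← lintegral_weight_mul_comp hφ hw h (F := fun x => ‖f x‖ₑ ^ 2) (by fun_prop)]
  simp only [enorm_mul, mul_pow]

lemma comp_ae_eq_zero_iff (hφ : Measurable φ) (hw : Measurable w) (h : WellDefined μ φ w)
    (f : Lp ℂ 2 μ) :
    (fun x => w x * f (φ x)) =ᵐ[μ] 0 ↔ ∀ᵐ x ∂μ, rn μ φ w x ≠ 0 → f x = 0 := by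
  have hf : Measurable f := (Lp.stronglyMeasurable f).measurable
  have h1 := lintegral_weight_mul_comp hφ hw h (F := fun x => ‖f x‖ₑ ^ 2) (by fun_prop)
  have h2 := lintegral_eq_zero_iff (μ := μ) (f := fun x => ‖w x‖ₑ ^ 2 * ‖f (φ x)‖ₑ ^ 2)
    (by fun_prop)
  have h3 := lintegral_eq_zero_iff (μ := μ) (f := fun x => rn μ φ w x * ‖f x‖ₑ ^ 2)
    (measurable_rn.mul (by fun_prop))
  rw [h1, h3] at h2
  constructor
  · intro h0
    have := h2.2 (by filter_upwards [h0] with x hx; simpa using hx)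
    filter_upwards [this] with x hx hx0
    simpa [hx0] using hx
  · intro h0
    have := h2.1 (by
      filter_upwards [h0] with x hx
      by_cases hx0 : rn μ φ w x = 0 <;> simp [hx0]
      simpa using hx hx0)
    filter_upwards [this] with x hx
    simpa using hx

/-- The kernel consists of the functions vanishing on `{h_{φ,w} ≠ 0}`, so restricting `f` to that
set splits off its part orthogonal to the kernel. The remainder is in the kernel, hence in the
domain, and so both parts are. -/
lemma hasReciprocal_op (hφ : Measurable φ) (hw : Measurable w) (h : WellDefined μ φ w) :
    PartialOp.HasReciprocal (op μ φ w hφ hw h) := by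
  have hker : ∀ {f : Lp ℂ 2 μ}, f ∈ PartialOp.ker (op μ φ w hφ hw h) ↔
      ∀ᵐ x ∂μ, rn μ φ w x ≠ 0 → f x = 0 := by
    intro f
    rw [PartialOp.mem_ker_iff, mem_graph_op_iff, ← comp_ae_eq_zero_iff hφ hw h]
    constructor
    · intro h1
      exact h1.symm.trans (Lp.coeFn_zero ℂ 2 μ)
    · intro h1
      exact (Lp.coeFn_zero ℂ 2 μ).trans h1.symm
  apply le_antisymm
  · intro f hf
    have hS : MeasurableSet {x | rn μ φ w x ≠ 0} :=
      measurable_rn (measurableSet_singleton 0).compl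
    obtain ⟨g, hg⟩ := exists_coeFn_ae_eq f
      (g := {x | rn μ φ w x ≠ 0}.indicator f)
      ((Lp.aestronglyMeasurable f).indicator hS) 1
      (.of_forall fun x => by rw [one_mul]; exact norm_indicator_le_norm_self _ _)
    have hfg : f - g ∈ PartialOp.ker (op μ φ w hφ hw h) := by
      rw [hker]
      filter_upwards [hg, Lp.coeFn_sub f g] with x h1 h2 hx
      rw [h2, Pi.sub_apply, h1, Set.indicator_of_mem (by exact hx), sub_self]
    have hkd : f - g ∈ (op μ φ w hφ hw h).domain :=
      PartialOp.mem_domain_iff.2 ⟨0, PartialOp.mem_ker_iff.1 hfg⟩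
    have hgd : g ∈ (op μ φ w hφ hw h).domain := by
      simpa using sub_mem hf hkd
    refine Submodule.mem_sup.2 ⟨f - g, hfg, g, ⟨hgd, ?_⟩, sub_add_cancel f g⟩
    rw [SetLike.mem_coe, Submodule.mem_orthogonal]
    intro u hu
    rw [hker] at hu
    rw [show inner ℂ u g = inner ℂ (0 : Lp ℂ 2 μ) g from ?_, inner_zero_left]
    apply inner_congr
    filter_upwards [hu, hg, Lp.coeFn_zero ℂ 2 μ] with x h1 h2 h3
    rw [h3, h2]
    by_cases hx : rn μ φ w x = 0
    · rw [Set.indicator_of_notMem (by simpa using hx)]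
      simp
    · simp [h1 hx]
  · refine sup_le ?_ inf_le_left
    intro f hf
    exact PartialOp.mem_domain_iff.2 ⟨0, PartialOp.mem_ker_iff.1 hf⟩

/-- Domain elements satisfy `∫ h_{φ,w}|f|² < ∞`, so they vanish on `{h_{φ,w} = ∞}`. The indicator of
a finite-measure subset of that set is then orthogonal to a dense subspace. -/
lemma rn_lt_top_of_dense (hφ : Measurable φ) (hw : Measurable w) (h : WellDefined μ φ w)
    (hd : Dense ((op μ φ w hφ hw h).domain : Set (Lp ℂ 2 μ))) :
    ∀ᵐ x ∂μ, rn μ φ w x < ∞ := by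
  have hA : MeasurableSet {x | rn μ φ w x = ∞} := measurable_rn (measurableSet_singleton ∞)
  by_contra hne
  have hpos : 0 < μ {x | rn μ φ w x = ∞} := by
    rw [pos_iff_ne_zero]
    intro h0
    apply hne
    filter_upwards [measure_eq_zero_iff_ae_notMem.1 h0] with x hx
    exact lt_top_iff_ne_top.2 hx
  obtain ⟨B, hB, hBA, hB0, hBt⟩ := Measure.exists_subset_measure_lt_top hA hpos
  let b : Lp ℂ 2 μ := indicatorConstLp 2 hB hBt.ne 1
  have hb : b = 0 := by
    refine hd.eq_zero_of_inner_left ℂ ?_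
    intro f hf
    have hf2 := (memLp_iff_lintegral_rn hφ hw h f).1 hf
    have hm : Measurable f := (Lp.stronglyMeasurable f).measurable
    have := ae_lt_top (measurable_rn.mul (by fun_prop)) hf2.ne
    rw [show inner ℂ b f = inner ℂ (0 : Lp ℂ 2 μ) f from ?_, inner_zero_left]
    apply inner_congr
    filter_upwards [this, Lp.coeFn_zero ℂ 2 μ,
      (indicatorConstLp_coeFn : indicatorConstLp 2 hB hBt.ne (1 : ℂ) =ᵐ[μ] _)] with x h1 h2 h3
    rw [h2, h3]
    by_cases hx : x ∈ B
    · have hx' : rn μ φ w x = ∞ := hBA hx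
      have : f x = 0 := by
        by_contra hfx
        rw [Pi.mul_apply, hx', ENNReal.top_mul (by simpa using hfx)] at h1
        exact lt_irrefl _ h1
      simp [this]
    · simp [hx]
  have : μ B = 0 := by
    have h3 := (indicatorConstLp_coeFn : indicatorConstLp 2 hB hBt.ne (1 : ℂ) =ᵐ[μ] _)
    change (b : X → ℂ) =ᵐ[μ] _ at h3
    rw [measure_eq_zero_iff_ae_notMem]
    rw [hb] at h3
    filter_upwards [h3, Lp.coeFn_zero ℂ 2 μ] with x h1 h2 hx
    rw [h2, Set.indicator_of_mem hx] at h1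
    exact zero_ne_one h1
  exact hB0.ne' this

end WeightedComp

/-! ### Weights bounded away from zero. -/

namespace WeightedComp

variable {X : Type*} [mX : MeasurableSpace X] {μ : Measure X} {φ : X → X} {w : X → ℂ}

lemma weightedMeasure_one : weightedMeasure μ 1 = μ := by
  simp [weightedMeasure]

lemma WellDefined.quasiMeasurePreserving (hφ : Measurable φ) (h1 : WellDefined μ φ 1) :
    Measure.QuasiMeasurePreserving φ μ μ :=
  ⟨hφ, by simpa only [WellDefined, weightedMeasure_one] using h1⟩

lemma WellDefined.one (hφ : Measurable φ) (hw : Measurable w) (h : WellDefined μ φ w)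
    (hw0 : ∀ᵐ x ∂μ, w x ≠ 0) : WellDefined μ φ 1 := by
  rw [WellDefined, weightedMeasure_one]
  refine Measure.AbsolutelyContinuous.trans (Measure.AbsolutelyContinuous.map ?_ hφ) h
  exact withDensity_absolutelyContinuous' (by fun_prop) (by simpa using hw0)

lemma mem_graph_compOp_iff (hφ : Measurable φ) (h1 : WellDefined μ φ 1) {f g : Lp ℂ 2 μ} :
    (f, g) ∈ (compOp μ φ hφ h1).graph ↔ g =ᵐ[μ] fun x => f (φ x) := by
  rw [compOp, mem_graph_op_iff]
  simp only [Pi.one_apply, one_mul]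

lemma mem_graph_mulOp_iff (hw : Measurable w) {f g : Lp ℂ 2 μ} :
    (f, g) ∈ (mulOp μ w hw).graph ↔ g =ᵐ[μ] fun x => w x * f x := by
  rw [mulOp, mem_graph_op_iff]
  rfl

section Bound

variable {α : ℝ}

lemma norm_le_of_lt_norm (hα : 0 < α) {a b : ℂ} (ha : α < ‖a‖) : ‖b‖ ≤ α⁻¹ * ‖a * b‖ := by
  rw [norm_mul, ← mul_assoc]
  refine le_mul_of_one_le_left (norm_nonneg _) ?_
  rw [← inv_mul_cancel₀ hα.ne']
  gcongr

lemma exists_coeFn_ae_eq_comp (hφ : Measurable φ) (hα : 0 < α) (hαw : ∀ᵐ x ∂μ, α < ‖w x‖)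
    {g y : Lp ℂ 2 μ} (hy : y =ᵐ[μ] fun x => w x * g (φ x)) :
    ∃ p : Lp ℂ 2 μ, p =ᵐ[μ] fun x => g (φ x) := by
  refine exists_coeFn_ae_eq y
    ((Lp.stronglyMeasurable g).measurable.comp hφ).aestronglyMeasurable α⁻¹ ?_
  filter_upwards [hy, hαw] with x h1 h2
  rw [h1]
  exact norm_le_of_lt_norm hα h2

/-- The lower bound on `|w|` puts `f∘φ` in `L²` whenever `w·(f∘φ)` is, so the natural domain of the
product loses nothing. -/
lemma op_eq_mul (hφ : Measurable φ) (hw : Measurable w) (h : WellDefined μ φ w)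
    (h1 : WellDefined μ φ 1) (hα : 0 < α) (hαw : ∀ᵐ x ∂μ, α < ‖w x‖) :
    op μ φ w hφ hw h = PartialOp.mul (mulOp μ w hw) (compOp μ φ hφ h1) := by
  apply LinearPMap.eq_of_eq_graph
  ext ⟨f, g⟩
  rw [PartialOp.mem_graph_mul_iff, mem_graph_op_iff]
  simp only [mem_graph_compOp_iff, mem_graph_mulOp_iff]
  constructor
  · intro hg
    obtain ⟨p, hp⟩ := exists_coeFn_ae_eq_comp hφ hα hαw hg
    refine ⟨p, hp, ?_⟩
    filter_upwards [hg, hp] with x h1 h2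
    rw [h1, h2]
  · rintro ⟨p, hp, hg⟩
    filter_upwards [hg, hp] with x h1 h2
    rw [h1, h2]

lemma dense_domain_compOp (hφ : Measurable φ) (hw : Measurable w) (h : WellDefined μ φ w)
    (h1 : WellDefined μ φ 1) (hα : 0 < α) (hαw : ∀ᵐ x ∂μ, α < ‖w x‖)
    (hd : Dense ((op μ φ w hφ hw h).domain : Set (Lp ℂ 2 μ))) :
    Dense ((compOp μ φ hφ h1).domain : Set (Lp ℂ 2 μ)) := by
  refine hd.mono fun f hf => ?_
  obtain ⟨g, hg⟩ := PartialOp.mem_domain_iff.1 hf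
  rw [mem_graph_op_iff] at hg
  obtain ⟨p, hp⟩ := exists_coeFn_ae_eq_comp hφ hα hαw hg
  exact PartialOp.mem_domain_iff.2 ⟨p, (mem_graph_compOp_iff hφ h1).2 hp⟩

lemma ker_op_eq_ker_compOp (hφ : Measurable φ) (hw : Measurable w) (h : WellDefined μ φ w)
    (h1 : WellDefined μ φ 1) (hw0 : ∀ᵐ x ∂μ, w x ≠ 0) :
    PartialOp.ker (op μ φ w hφ hw h) = PartialOp.ker (compOp μ φ hφ h1) := by
  ext f
  rw [PartialOp.mem_ker_iff, PartialOp.mem_ker_iff, mem_graph_op_iff, mem_graph_compOp_iff]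
  constructor
  · intro hf
    filter_upwards [hf, hw0, Lp.coeFn_zero ℂ 2 μ] with x h1 h2 h3
    rw [h3] at h1 ⊢
    simpa [h2, eq_comm] using h1
  · intro hf
    filter_upwards [hf, Lp.coeFn_zero ℂ 2 μ] with x h1 h3
    rw [h3] at h1 ⊢
    simp [← h1]

lemma exists_coeFn_ae_eq_div (hw : Measurable w) (hα : 0 < α) (hαw : ∀ᵐ x ∂μ, α < ‖w x‖)
    (f : Lp ℂ 2 μ) : ∃ z : Lp ℂ 2 μ, f =ᵐ[μ] fun x => w x * z x := by
  have hf := (Lp.stronglyMeasurable f).measurable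
  obtain ⟨z, hz⟩ := exists_coeFn_ae_eq f (g := fun x => f x / w x)
    (hf.div hw).aestronglyMeasurable α⁻¹ (by
      filter_upwards [hαw] with x hx
      have hx0 : w x ≠ 0 := norm_pos_iff.1 (hα.trans hx)
      simpa [mul_div_cancel₀ _ hx0] using norm_le_of_lt_norm hα hx (b := f x / w x))
  refine ⟨z, ?_⟩
  filter_upwards [hz, hαw] with x h1 h2
  have hx0 : w x ≠ 0 := norm_pos_iff.1 (hα.trans h2)
  rw [h1, mul_div_cancel₀ _ hx0]

/-- `M_w` is injective with full range, so its reciprocal is its inverse. -/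
lemma mem_graph_reciprocal_mulOp_iff (hw : Measurable w) (hα : 0 < α)
    (hαw : ∀ᵐ x ∂μ, α < ‖w x‖) {f z : Lp ℂ 2 μ} :
    (f, z) ∈ (PartialOp.reciprocal (mulOp μ w hw)).graph ↔ f =ᵐ[μ] fun x => w x * z x := by
  have hk : PartialOp.ker (mulOp μ w hw) = ⊥ := by
    rw [eq_bot_iff]
    intro f hf
    rw [PartialOp.mem_ker_iff, mem_graph_mulOp_iff] at hf
    rw [Submodule.mem_bot, Lp.eq_zero_iff_ae_eq_zero]
    filter_upwards [hf, hαw, Lp.coeFn_zero ℂ 2 μ] with x h1 h2 h3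
    rw [h3] at h1
    have hx0 : w x ≠ 0 := norm_pos_iff.1 (hα.trans h2)
    simpa [hx0, eq_comm] using h1
  have hr : PartialOp.range (mulOp μ w hw) = ⊤ := by
    rw [eq_top_iff]
    intro f _
    obtain ⟨z, hz⟩ := exists_coeFn_ae_eq_div hw hα hαw f
    exact PartialOp.mem_range_iff.2 ⟨z, (mem_graph_mulOp_iff hw).2 hz⟩
  rw [PartialOp.mem_graph_reciprocal_iff, hk, hr]
  simp only [mem_graph_mulOp_iff, Submodule.bot_orthogonal_eq_top, Submodule.mem_top, true_and,
    Submodule.top_orthogonal_eq_bot, Submodule.mem_bot, sub_eq_zero, exists_eq_right']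

end Bound

lemma mem_range_op_iff (hφ : Measurable φ) (hw : Measurable w) (h : WellDefined μ φ w)
    {p : Lp ℂ 2 μ} :
    p ∈ PartialOp.range (op μ φ w hφ hw h) ↔ ∃ q : Lp ℂ 2 μ, p =ᵐ[μ] fun x => w x * q (φ x) := by
  simp only [PartialOp.mem_range_iff, mem_graph_op_iff]

lemma mem_range_compOp_iff (hφ : Measurable φ) (h1 : WellDefined μ φ 1) {p : Lp ℂ 2 μ} :
    p ∈ PartialOp.range (compOp μ φ hφ h1) ↔ ∃ q : Lp ℂ 2 μ, p =ᵐ[μ] fun x => q (φ x) := by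
  simp only [PartialOp.mem_range_iff, mem_graph_compOp_iff]

end WeightedComp

/-! ### Radon–Nikodym derivatives: condition (i) is automatic. -/

namespace WeightedComp

variable {X : Type*} [mX : MeasurableSpace X] {μ : Measure X} [SigmaFinite μ] {φ : X → X}
  {w : X → ℂ}

lemma setLIntegral_rn (hφ : Measurable φ) (h : WellDefined μ φ w) {s : Set X}
    (hs : MeasurableSet s) : ∫⁻ x in s, rn μ φ w x ∂μ = ∫⁻ x in φ ⁻¹' s, ‖w x‖ₑ ^ 2 ∂μ := by
  rw [← withDensity_apply _ hs, withDensity_rn h, Measure.map_apply hφ hs, weightedMeasure,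
    withDensity_apply _ (hφ hs)]

lemma setLIntegral_rn_one (hφ : Measurable φ) (h1 : WellDefined μ φ 1) {s : Set X}
    (hs : MeasurableSet s) : ∫⁻ x in s, rn μ φ 1 x ∂μ = μ (φ ⁻¹' s) := by
  rw [setLIntegral_rn hφ h1 hs]
  simp

lemma mul_rn_one_le (hφ : Measurable φ) (h : WellDefined μ φ w) (h1 : WellDefined μ φ 1) {α : ℝ}
    (hαw : ∀ᵐ x ∂μ, α < ‖w x‖) :
    ∀ᵐ x ∂μ, ENNReal.ofReal α ^ 2 * rn μ φ 1 x ≤ rn μ φ w x := by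
  refine ae_le_of_forall_setLIntegral_le_of_sigmaFinite (measurable_rn.const_mul _) ?_
  intro s hs _
  rw [lintegral_const_mul _ measurable_rn, setLIntegral_rn_one hφ h1 hs, setLIntegral_rn hφ h hs,
    ← setLIntegral_const]
  refine lintegral_mono_ae (ae_restrict_of_ae ?_)
  filter_upwards [hαw] with x hx
  gcongr
  rw [← ofReal_norm]
  exact ENNReal.ofReal_le_ofReal hx.le

lemma rn_eq_zero_of_rn_one (hφ : Measurable φ) (h : WellDefined μ φ w) (h1 : WellDefined μ φ 1) :
    ∀ᵐ x ∂μ, rn μ φ 1 x = 0 → rn μ φ w x = 0 := by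
  have hs : MeasurableSet {x | rn μ φ 1 x = 0} := measurable_rn (measurableSet_singleton 0)
  have h0 : μ (φ ⁻¹' {x | rn μ φ 1 x = 0}) = 0 := by
    rw [← setLIntegral_rn_one hφ h1 hs, setLIntegral_eq_zero_iff hs measurable_rn]
    exact .of_forall fun x hx => hx
  have h2 := setLIntegral_rn hφ h hs
  rw [setLIntegral_measure_zero _ _ h0, setLIntegral_eq_zero_iff hs measurable_rn] at h2
  exact h2

/-- `|ŵ|²` is `|w|²` times a function of `φ`, so the change of variables applies. The result is
`1/h_{φ,w}` where `0 < h_{φ,w} < ∞`, and `0` elsewhere by the conventions for `toReal` and inverses.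
-/
lemma rn_hat (hφ : Measurable φ) (hw : Measurable w) (h : WellDefined μ φ w) :
    rn μ φ (hat μ φ w) =ᵐ[μ] fun x => rn μ φ w x * ‖((rn μ φ w x).toReal)⁻¹‖ₑ ^ 2 := by
  have hr : Measurable (rn μ φ w) := measurable_rn
  have key : (weightedMeasure μ (hat μ φ w)).map φ =
      μ.withDensity fun x => rn μ φ w x * ‖((rn μ φ w x).toReal)⁻¹‖ₑ ^ 2 := by
    ext s hs
    rw [Measure.map_apply hφ hs, weightedMeasure, withDensity_apply _ (hφ hs),
      withDensity_apply _ hs, ← lintegral_indicator (hφ hs), ← lintegral_indicator hs]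
    have := lintegral_weight_mul_comp hφ hw h
      (F := s.indicator fun x => ‖((rn μ φ w x).toReal)⁻¹‖ₑ ^ 2)
      (Measurable.indicator (by fun_prop) hs)
    convert this using 2
    · ext x
      by_cases hx : φ x ∈ s
      · rw [Set.indicator_of_mem (by exact hx), Set.indicator_of_mem hx, hat, div_eq_mul_inv,
          enorm_mul, mul_pow, ← Complex.ofReal_inv]
        congr 2
        exact enorm_eq_iff_norm_eq.2 (Complex.norm_real _)
      · rw [Set.indicator_of_notMem (by exact hx), Set.indicator_of_notMem hx, mul_zero]
    · ext x
      by_cases hx : x ∈ s <;> simp [hx]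
  rw [rn, key]
  exact Measure.rnDeriv_withDensity _ (by fun_prop)

lemma mul_enorm_inv_sq_le {α : ℝ} (hα : 0 < α) {a b : ℝ≥0∞} (ha : a < ∞)
    (hb : b = 0 → a = 0) (hab : ENNReal.ofReal α ^ 2 * b ≤ a) :
    a * ‖a.toReal⁻¹‖ₑ ^ 2 ≤ ENNReal.ofReal (α⁻¹ ^ 2) * (b * ‖b.toReal⁻¹‖ₑ ^ 2) := by
  by_cases ha0 : a = 0
  · simp [ha0]
  have hb0 : b ≠ 0 := fun h => ha0 (hb h)
  have hbt : b ≠ ∞ := by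
    rintro rfl
    rw [ENNReal.mul_top (by simpa using hα)] at hab
    exact absurd ha hab.not_gt
  have aux : ∀ c : ℝ≥0∞, c ≠ 0 → c ≠ ∞ → c * ‖c.toReal⁻¹‖ₑ ^ 2 = c⁻¹ := by
    intro c h0 ht
    have : ‖c.toReal⁻¹‖ₑ = c⁻¹ := by
      rw [← ofReal_norm, Real.norm_of_nonneg (by positivity), ← ENNReal.toReal_inv,
        ENNReal.ofReal_toReal (by simpa using h0)]
    rw [this, sq, ← mul_assoc, ENNReal.mul_inv_cancel h0 ht, one_mul]
  rw [aux a ha0 ha.ne, aux b hb0 hbt, ENNReal.ofReal_pow (by positivity), ENNReal.ofReal_inv_of_pos hα,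
    ← ENNReal.inv_pow, ← ENNReal.mul_inv (by simp [hα]) (by simp)]
  exact ENNReal.inv_le_inv.2 hab

lemma rn_hat_le (hφ : Measurable φ) (hw : Measurable w) (h : WellDefined μ φ w)
    (h1 : WellDefined μ φ 1) (hfin : ∀ᵐ x ∂μ, rn μ φ w x < ∞) {α : ℝ}
    (hα : 0 < α) (hαw : ∀ᵐ x ∂μ, α < ‖w x‖) :
    ∀ᵐ x ∂μ, rn μ φ (hat μ φ w) x ≤ ENNReal.ofReal (α⁻¹ ^ 2) * rn μ φ (hat μ φ 1) x := by
  filter_upwards [rn_hat hφ hw h, rn_hat hφ measurable_one h1, hfin, mul_rn_one_le hφ h h1 hαw,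
    rn_eq_zero_of_rn_one hφ h h1] with x e1 e2 e3 e4 e5
  rw [e1, e2]
  exact mul_enorm_inv_sq_le hα e3 e5 e4

lemma sigmaFinite_map (h1 : WellDefined μ φ 1) (hfin : ∀ᵐ x ∂μ, rn μ φ 1 x < ∞) :
    SigmaFinite (μ.map φ) := by
  have := withDensity_rn h1
  rw [weightedMeasure_one] at this
  rw [← this]
  exact SigmaFinite.withDensity_of_ne_top (hfin.mono fun x hx => hx.ne)

/-! ### Conditional expectation and factorization through `φ`. -/

omit [SigmaFinite μ] in
-- The trimmed measure still pushes forward to `μ.map φ`, and σ-finiteness pulls back. This lets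
-- `E_φ` fix the `φ⁻¹(𝒜)`-measurable functions.
lemma sigmaFinite_trim_comap (hφ : Measurable φ) [hs : SigmaFinite (μ.map φ)] :
    SigmaFinite (μ.trim hφ.comap_le) := by
  have hm : Measurable[mX.comap φ] φ := comap_measurable φ
  have : @Measure.map X X (mX.comap φ) mX φ (μ.trim hφ.comap_le) = μ.map φ := by
    ext s hs
    rw [@Measure.map_apply _ _ (mX.comap φ) _ _ _ hm _ hs, Measure.map_apply hφ hs,
      trim_measurableSet_eq _ (hm hs)]
  exact @SigmaFinite.of_map _ _ (mX.comap φ) _ _ _ hm.aemeasurable (this ▸ hs)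

omit [SigmaFinite μ] in
lemma eq_condE_of_ae_eq (hφ : Measurable φ) [SigmaFinite (μ.map φ)] {f g : X → ℝ≥0∞}
    (hg : Measurable[mX.comap φ] g) (hfg : f =ᵐ[μ] g) : f =ᵐ[μ] condE μ φ f := by
  have := sigmaFinite_trim_comap (μ := μ) hφ
  have h2 := condLExp_congr_ae (mΩ := mX.comap φ) hfg
  rw [condLExp_eq_self hφ.comap_le μ hg] at h2
  exact hfg.trans h2.symm

omit [SigmaFinite μ] in
lemma exists_comp_eq_of_eq_condE {α : ℝ} (hα : 0 < α) (hαw : ∀ᵐ x ∂μ, α < ‖w x‖)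
    (h : ∀ᵐ x ∂μ, ‖w x‖ₑ ^ 2 = condE μ φ (fun y => ‖w y‖ₑ ^ 2) x) :
    ∃ u : X → ℝ, Measurable u ∧ (∀ x, α ^ 2 ≤ u x) ∧ ∀ᵐ x ∂μ, ‖w x‖ ^ 2 = u (φ x) := by
  obtain ⟨v, hv, hv2⟩ := (measurable_condLExp (mX.comap φ) μ
    (fun y => ‖w y‖ₑ ^ 2)).exists_eq_measurable_comp
  -- The maximum makes the lower bound hold everywhere, so that division by `u` preserves `L²`; at
  -- `φ x` it changes nothing for a.e. `x`.
  refine ⟨fun x => max (α ^ 2) (v x).toReal, by fun_prop, fun x => le_max_left _ _, ?_⟩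
  filter_upwards [h, hαw] with x hx hx2
  rw [condE, hv2] at hx
  have : (v (φ x)).toReal = ‖w x‖ ^ 2 := by
    rw [← Function.comp_apply (f := v), ← hx]
    simp
  rw [this, max_eq_right]
  gcongr

end WeightedComp

/-! ### Sufficiency of (ii). -/

namespace WeightedComp

variable {X : Type*} [mX : MeasurableSpace X] {μ : Measure X} {φ : X → X} {w : X → ℂ}

section Factor

variable {α : ℝ} {u : X → ℝ}

/-- If `|w|² = u ∘ φ`, multiplication by `1 / w̄` maps the range of `C_φ` into that of `C_{φ,w}`. -/
lemma div_mem_orthogonal_range (hφ : Measurable φ) (hw : Measurable w) (h : WellDefined μ φ w)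
    (h1 : WellDefined μ φ 1) (hα : 0 < α) (hαw : ∀ᵐ x ∂μ, α < ‖w x‖) (hu : Measurable u)
    (hαu : ∀ x, α ^ 2 ≤ u x) (hwu : ∀ᵐ x ∂μ, ‖w x‖ ^ 2 = u (φ x)) {k z : Lp ℂ 2 μ}
    (hk : k ∈ (PartialOp.range (op μ φ w hφ hw h))ᗮ) (hz : k =ᵐ[μ] fun x => w x * z x) :
    z ∈ (PartialOp.range (compOp μ φ hφ h1))ᗮ := by
  have hq := h1.quasiMeasurePreserving hφ
  rw [Submodule.mem_orthogonal] at hk ⊢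
  intro p hp
  obtain ⟨q, hpq⟩ := (mem_range_compOp_iff hφ h1).1 hp
  have hqm := (Lp.stronglyMeasurable q).measurable
  -- With `q' = q/u` one gets `w·(q'∘φ) = (q∘φ)/w̄`.
  obtain ⟨q', hq'⟩ := exists_coeFn_ae_eq q (g := fun x => q x / (u x : ℂ))
    (hqm.div (Complex.measurable_ofReal.comp hu)).aestronglyMeasurable (α ^ 2)⁻¹ (.of_forall fun x => by
      have : 0 < u x := (by positivity : 0 < α ^ 2).trans_le (hαu x)
      rw [norm_div, Complex.norm_of_nonneg this.le, div_eq_inv_mul]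
      gcongr
      exact hαu x)
  have hq'φ := hq.ae_eq_comp hq'
  obtain ⟨p', hp'⟩ := exists_coeFn_ae_eq p (g := fun x => w x * q' (φ x))
    ((hw.mul ((Lp.stronglyMeasurable q').measurable.comp hφ)).aestronglyMeasurable) α⁻¹ (by
      filter_upwards [hq'φ, hpq, hαw, hwu] with x e1 e2 e3 e4
      simp only [Function.comp_apply] at e1
      have hw0 : 0 < ‖w x‖ := hα.trans e3
      rw [e1, e2, ← e4, norm_mul, norm_div, Complex.norm_of_nonneg (by positivity)]
      calc ‖w x‖ * (‖q (φ x)‖ / ‖w x‖ ^ 2) = ‖w x‖⁻¹ * ‖q (φ x)‖ := by field_simp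
        _ ≤ _ := by gcongr)
  rw [← hk p' ((mem_range_op_iff hφ hw h).2 ⟨q', hp'⟩)]
  apply inner_congr
  filter_upwards [hq'φ, hpq, hαw, hwu, hp', hz] with x e1 e2 e3 e4 e5 e6
  simp only [Function.comp_apply] at e1
  have hw0 : w x ≠ 0 := norm_pos_iff.1 (hα.trans e3)
  have hw1 : (starRingEnd ℂ) (w x) ≠ 0 := by simpa using hw0
  have e7 : (u (φ x) : ℂ) = w x * (starRingEnd ℂ) (w x) := by
    rw [Complex.mul_conj', ← e4]
    simp
  rw [e5, e6, e1, e2, e7]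
  simp only [RCLike.inner_apply, map_mul, map_div₀, Complex.conj_conj]
  field_simp

/-- Truncation to `{u ≤ n²}` of an identity `⟨w · (q ∘ φ), w · z⟩ = ⟨|w|² (q ∘ φ), z⟩`. -/
lemma inner_truncation_eq_zero (hφ : Measurable φ) (h1 : WellDefined μ φ 1) (hu : Measurable u)
    (hu0 : ∀ x, 0 ≤ u x) (hwu : ∀ᵐ x ∂μ, ‖w x‖ ^ 2 = u (φ x)) {q p z r a : Lp ℂ 2 μ}
    (hp : p =ᵐ[μ] fun x => q (φ x)) (hz : z ∈ (PartialOp.range (compOp μ φ hφ h1))ᗮ) (n : ℕ)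
    (ha : a =ᵐ[μ] (φ ⁻¹' {x | u x ≤ (n : ℝ) ^ 2}).indicator fun x => w x * q (φ x))
    (hr : ∀ᵐ x ∂μ, φ x ∈ {x | u x ≤ (n : ℝ) ^ 2} → r x = w x * z x) :
    inner ℂ a r = 0 := by
  have hq := h1.quasiMeasurePreserving hφ
  have hqm := (Lp.stronglyMeasurable q).measurable
  have hS : MeasurableSet {x | u x ≤ (n : ℝ) ^ 2} := measurableSet_le hu measurable_const
  obtain ⟨q', hq'⟩ := exists_coeFn_ae_eq q
    (g := {x | u x ≤ (n : ℝ) ^ 2}.indicator fun x => (u x : ℂ) * q x)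
    ((Measurable.indicator (by fun_prop) hS).aestronglyMeasurable) ((n : ℝ) ^ 2)
    (.of_forall fun x => by
      by_cases hx : x ∈ {x | u x ≤ (n : ℝ) ^ 2}
      · rw [Set.indicator_of_mem hx, norm_mul, Complex.norm_of_nonneg (hu0 x)]
        gcongr
        exact hx
      · rw [Set.indicator_of_notMem hx, norm_zero]
        positivity)
  have hq'φ := hq.ae_eq_comp hq'
  obtain ⟨p', hp'⟩ := exists_coeFn_ae_eq p (g := fun x => q' (φ x))
    ((Lp.stronglyMeasurable q').measurable.comp hφ).aestronglyMeasurable ((n : ℝ) ^ 2) (by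
      filter_upwards [hq'φ, hp] with x e1 e2
      simp only [Function.comp_apply] at e1
      rw [e1, e2]
      by_cases hx : φ x ∈ {x | u x ≤ (n : ℝ) ^ 2}
      · rw [Set.indicator_of_mem hx, norm_mul, Complex.norm_of_nonneg (hu0 _)]
        gcongr
        exact hx
      · rw [Set.indicator_of_notMem hx, norm_zero]
        positivity)
  rw [Submodule.mem_orthogonal] at hz
  rw [← hz p' ((mem_range_compOp_iff hφ h1).2 ⟨q', hp'⟩)]
  apply inner_congr
  filter_upwards [hq'φ, hp', ha, hr, hwu] with x e1 e2 e3 e4 e5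
  simp only [Function.comp_apply] at e1
  rw [e2, e1, e3]
  by_cases hx : φ x ∈ {x | u x ≤ (n : ℝ) ^ 2}
  · have e7 : (u (φ x) : ℂ) = w x * (starRingEnd ℂ) (w x) := by
      rw [Complex.mul_conj', ← e5]
      simp
    rw [e4 hx, Set.indicator_of_mem hx, Set.indicator_of_mem (by exact hx), e7]
    simp only [RCLike.inner_apply, map_mul, Complex.conj_conj]
    ring
  · rw [Set.indicator_of_notMem hx, Set.indicator_of_notMem (by exact hx)]
    simp

/-- On the truncation set `|w| ≤ n`, so `n|p|` dominates. -/
lemma exists_truncation (hφ : Measurable φ) (hw : Measurable w) (hu : Measurable u)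
    (hwu : ∀ᵐ x ∂μ, ‖w x‖ ^ 2 = u (φ x)) {q p : Lp ℂ 2 μ} (hp : p =ᵐ[μ] fun x => q (φ x))
    (n : ℕ) : ∃ a : Lp ℂ 2 μ,
      a =ᵐ[μ] (φ ⁻¹' {x | u x ≤ (n : ℝ) ^ 2}).indicator fun x => w x * q (φ x) := by
  have hqm := (Lp.stronglyMeasurable q).measurable
  have hS : MeasurableSet (φ ⁻¹' {x | u x ≤ (n : ℝ) ^ 2}) :=
    hφ (measurableSet_le hu measurable_const)
  refine exists_coeFn_ae_eq p (Measurable.indicator (by fun_prop) hS).aestronglyMeasurable n ?_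
  filter_upwards [hwu, hp] with x e1 e2
  by_cases hx : x ∈ φ ⁻¹' {x | u x ≤ (n : ℝ) ^ 2}
  · rw [Set.indicator_of_mem hx, norm_mul, e2]
    gcongr
    have : u (φ x) ≤ (n : ℝ) ^ 2 := hx
    rw [← e1] at this
    exact le_of_sq_le_sq this (by positivity)
  · rw [Set.indicator_of_notMem hx, norm_zero]
    positivity

omit mX in
lemma tendsto_truncation (u : X → ℝ) (b : X → ℂ) (x : X) :
    Filter.Tendsto (fun n : ℕ => (φ ⁻¹' {x | u x ≤ (n : ℝ) ^ 2}).indicator b x) Filter.atTop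
      (nhds (b x)) := by
  obtain ⟨N, hN⟩ := exists_nat_ge (u (φ x))
  refine tendsto_const_nhds.congr' ?_
  -- `n ≥ 1` is needed for `n ≤ n²`.
  filter_upwards [Filter.eventually_ge_atTop (max N 1)] with n hn
  rw [Set.indicator_of_mem]
  have h1 : (1 : ℝ) ≤ n := by exact_mod_cast (le_max_right N 1).trans hn
  have h2 : (N : ℝ) ≤ n := by exact_mod_cast (le_max_left N 1).trans hn
  exact hN.trans (h2.trans (le_self_pow₀ h1 two_ne_zero))

lemma norm_le_of_inner_sub_eq_zero {H : Type*} [NormedAddCommGroup H] [InnerProductSpace ℂ H]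
    {a f : H} (h : inner ℂ a (f - a) = 0) : ‖a‖ ≤ ‖f‖ := by
  have := norm_add_sq_eq_norm_sq_add_norm_sq_of_inner_eq_zero a (f - a) h
  rw [add_sub_cancel] at this
  nlinarith [norm_nonneg a, norm_nonneg f, mul_self_nonneg ‖f - a‖]

/-- The truncations `a n` of `w·(g∘φ)` satisfy `a n ⊥ f - a n`, because `f - a n = w·(z - p)` on the
truncation set. By Pythagoras `‖a n‖ ≤ ‖f‖`, and this bound passes to the pointwise limit. -/
lemma memLp_of_mul_sub_mem (hφ : Measurable φ) (hw : Measurable w) (h1 : WellDefined μ φ 1)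
    (hu : Measurable u) (hu0 : ∀ x, 0 ≤ u x) (hwu : ∀ᵐ x ∂μ, ‖w x‖ ^ 2 = u (φ x))
    {f z g p : Lp ℂ 2 μ} (hf : f =ᵐ[μ] fun x => w x * z x) (hp : p =ᵐ[μ] fun x => g (φ x))
    (hz : z - p ∈ (PartialOp.range (compOp μ φ hφ h1))ᗮ) :
    ∃ y : Lp ℂ 2 μ, y =ᵐ[μ] fun x => w x * g (φ x) := by
  have hg := (Lp.stronglyMeasurable g).measurable
  choose a ha using exists_truncation hφ hw hu hwu hp
  have hle : ∀ n, ‖a n‖ ≤ ‖f‖ := by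
    intro n
    refine norm_le_of_inner_sub_eq_zero
      (inner_truncation_eq_zero hφ h1 hu hu0 hwu hp hz n (ha n) ?_)
    filter_upwards [ha n, hf, hp, Lp.coeFn_sub f (a n), Lp.coeFn_sub z p] with x e1 e2 e3 e4 e5 hx
    rw [e4, e5, Pi.sub_apply, Pi.sub_apply, e2, e3, e1, Set.indicator_of_mem (by exact hx)]
    ring
  refine ⟨_, MemLp.coeFn_toLp (⟨by fun_prop, lt_of_le_of_lt
    (Lp.eLpNorm_le_of_ae_tendsto (u := Filter.atTop) (f := fun n => a n) (C := eLpNorm f 2 μ)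
      (.of_forall fun n => ?_) (fun n => Lp.aestronglyMeasurable _) ?_) (Lp.eLpNorm_lt_top f)⟩)⟩
  · have := hle n
    rw [Lp.norm_def, Lp.norm_def] at this
    exact (ENNReal.toReal_le_toReal (Lp.eLpNorm_ne_top _) (Lp.eLpNorm_ne_top _)).1 this
  · filter_upwards [ae_all_iff.2 ha] with x hx
    simp only [hx]
    exact tendsto_truncation u (fun x => w x * g (φ x)) x

/-- Here `u·q` need not be in `L²`, so orthogonality is proved for truncations of `w·(q∘φ)` and
passes to the limit by dominated convergence. -/
lemma mul_mem_orthogonal_range (hφ : Measurable φ) (hw : Measurable w) (h : WellDefined μ φ w)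
    (h1 : WellDefined μ φ 1) (hα : 0 < α) (hαw : ∀ᵐ x ∂μ, α < ‖w x‖) (hu : Measurable u)
    (hu0 : ∀ x, 0 ≤ u x) (hwu : ∀ᵐ x ∂μ, ‖w x‖ ^ 2 = u (φ x)) {k z : Lp ℂ 2 μ}
    (hz : z ∈ (PartialOp.range (compOp μ φ hφ h1))ᗮ) (hk : k =ᵐ[μ] fun x => w x * z x) :
    k ∈ (PartialOp.range (op μ φ w hφ hw h))ᗮ := by
  rw [Submodule.mem_orthogonal]
  intro y hy
  obtain ⟨q, hq⟩ := (mem_range_op_iff hφ hw h).1 hy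
  obtain ⟨p, hp⟩ := exists_coeFn_ae_eq_comp hφ hα hαw hq
  choose a ha using exists_truncation hφ hw hu hwu hp
  have h0 : ∀ n, inner ℂ (a n) k = 0 := fun n =>
    inner_truncation_eq_zero hφ h1 hu hu0 hwu hp hz n (ha n) (hk.mono fun x hx _ => hx)
  have hlim := tendsto_integral_of_dominated_convergence (μ := μ)
    (F := fun n x => inner ℂ (a n x) (k x)) (f := fun x => inner ℂ (y x) (k x))
    (fun x => ‖inner ℂ (y x) (k x)‖) (fun n => (L2.integrable_inner (a n) k).aestronglyMeasurable)
    (L2.integrable_inner y k).norm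
    (fun n => by
      filter_upwards [ha n, hq] with x e1 e2
      by_cases hx : x ∈ φ ⁻¹' {x | u x ≤ (n : ℝ) ^ 2}
      · rw [e1, e2, Set.indicator_of_mem hx]
      · rw [e1, Set.indicator_of_notMem hx, inner_zero_left, norm_zero]
        positivity)
    (by
      filter_upwards [ae_all_iff.2 ha, hq] with x e1 e2
      simp only [e1, e2]
      exact (tendsto_truncation u (fun x => w x * q (φ x)) x).inner tendsto_const_nhds)
  simp only [← L2.inner_def, h0] at hlim
  exact (tendsto_nhds_unique hlim tendsto_const_nhds)

lemma reciprocal_op_eq_of_factor (hφ : Measurable φ) (hw : Measurable w) (h : WellDefined μ φ w)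
    (h1 : WellDefined μ φ 1) (hα : 0 < α) (hαw : ∀ᵐ x ∂μ, α < ‖w x‖) (hu : Measurable u)
    (hαu : ∀ x, α ^ 2 ≤ u x) (hwu : ∀ᵐ x ∂μ, ‖w x‖ ^ 2 = u (φ x)) :
    PartialOp.reciprocal (op μ φ w hφ hw h) =
      PartialOp.mul (PartialOp.reciprocal (compOp μ φ hφ h1))
        (PartialOp.reciprocal (mulOp μ w hw)) := by
  have hu0 : ∀ x, 0 ≤ u x := fun x => (sq_nonneg α).trans (hαu x)
  have hker := ker_op_eq_ker_compOp hφ hw h h1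
    (hαw.mono fun x hx => norm_pos_iff.1 (hα.trans hx))
  apply LinearPMap.eq_of_eq_graph
  ext ⟨f, g⟩
  rw [PartialOp.mem_graph_mul_iff, PartialOp.mem_graph_reciprocal_iff]
  simp only [mem_graph_reciprocal_mulOp_iff hw hα hαw, PartialOp.mem_graph_reciprocal_iff,
    mem_graph_op_iff, mem_graph_compOp_iff, hker]
  constructor
  · rintro ⟨y, hy, hg, hfy⟩
    obtain ⟨z, hz⟩ := exists_coeFn_ae_eq_div hw hα hαw f
    obtain ⟨p, hp⟩ := exists_coeFn_ae_eq_comp hφ hα hαw hy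
    refine ⟨z, hz, p, hp, hg,
      div_mem_orthogonal_range hφ hw h h1 hα hαw hu hαu hwu hfy ?_⟩
    filter_upwards [hz, hp, hy, Lp.coeFn_sub f y, Lp.coeFn_sub z p] with x e1 e2 e3 e4 e5
    rw [e4, e5, Pi.sub_apply, Pi.sub_apply, e1, e2, e3]
    ring
  · rintro ⟨z, hz, p, hp, hg, hzp⟩
    obtain ⟨y, hy⟩ := memLp_of_mul_sub_mem hφ hw h1 hu hu0 hwu hz hp hzp
    refine ⟨y, hy, hg, mul_mem_orthogonal_range hφ hw h h1 hα hαw hu hu0 hwu hzp ?_⟩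
    filter_upwards [hz, hp, hy, Lp.coeFn_sub f y, Lp.coeFn_sub z p] with x e1 e2 e3 e4 e5
    rw [e4, e5, Pi.sub_apply, Pi.sub_apply, e1, e2, e3]
    ring

end Factor

end WeightedComp

/-! ### Necessity of (ii). -/

namespace WeightedComp

variable {X : Type*} [mX : MeasurableSpace X] {μ : Measure X} {φ : X → X} {w : X → ℂ}

lemma div_mem_orthogonal_range_of_eq {α : ℝ} (hφ : Measurable φ) (hw : Measurable w)
    (h : WellDefined μ φ w) (h1 : WellDefined μ φ 1) (hα : 0 < α) (hαw : ∀ᵐ x ∂μ, α < ‖w x‖)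
    (heq : PartialOp.reciprocal (op μ φ w hφ hw h) =
      PartialOp.mul (PartialOp.reciprocal (compOp μ φ hφ h1))
        (PartialOp.reciprocal (mulOp μ w hw))) {k z : Lp ℂ 2 μ}
    (hk : k ∈ (PartialOp.range (op μ φ w hφ hw h))ᗮ) (hz : k =ᵐ[μ] fun x => w x * z x) :
    z ∈ (PartialOp.range (compOp μ φ hφ h1))ᗮ := by
  -- Vectors orthogonal to the range are those that the reciprocal sends to `0`.
  have hm : (k, (0 : Lp ℂ 2 μ)) ∈ (PartialOp.reciprocal (op μ φ w hφ hw h)).graph :=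
    PartialOp.mem_graph_reciprocal_iff.2 ⟨0, zero_mem _, zero_mem _, by simpa using hk⟩
  rw [heq, PartialOp.mem_graph_mul_iff] at hm
  obtain ⟨z', hz', hm⟩ := hm
  rw [mem_graph_reciprocal_mulOp_iff hw hα hαw] at hz'
  obtain ⟨y, hy, -, hzy⟩ := PartialOp.mem_graph_reciprocal_iff.1 hm
  have hy0 : y = 0 := LinearPMap.graph_fst_eq_zero_snd _ hy rfl
  have hzz : z = z' := by
    apply Lp.ext
    filter_upwards [hz, hz', hαw] with x e1 e2 e3
    exact mul_left_cancel₀ (norm_pos_iff.1 (hα.trans e3)) (e1.symm.trans e2)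
  rw [hzz]
  simpa [hy0] using hzy

/-- A strictly positive `f ∈ L²(μ)` with `f ∘ φ ∈ L²(μ)`. -/
lemma exists_pos_memLp_comp [SigmaFinite μ] (hφ : Measurable φ) [SigmaFinite (μ.map φ)] :
    ∃ f : X → ℝ, Measurable f ∧ (∀ x, 0 < f x) ∧ MemLp (fun x => (f x : ℂ)) 2 μ ∧
      MemLp (fun x => (f (φ x) : ℂ)) 2 μ := by
  -- Integrating against the sum of the two measures controls `g` and `g∘φ` at once; the square root
  -- of `g` is then the required function.
  obtain ⟨g, hg0, hg, hlt⟩ := exists_pos_lintegral_lt_of_sigmaFinite (μ + μ.map φ) one_ne_zero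
  rw [lintegral_add_measure, lintegral_map (by fun_prop) hφ] at hlt
  have key : ∀ x, ‖((Real.sqrt (g x) : ℝ) : ℂ)‖ₑ ^ 2 = g x := by
    intro x
    rw [← ofReal_norm, Complex.norm_of_nonneg (Real.sqrt_nonneg _),
      ← ENNReal.ofReal_pow (Real.sqrt_nonneg _), Real.sq_sqrt (by positivity),
      ENNReal.ofReal_coe_nnreal]
  have hs : Measurable fun x => Real.sqrt (g x) := by fun_prop
  refine ⟨fun x => Real.sqrt (g x), hs, fun x => Real.sqrt_pos.2 (hg0 x), ?_, ?_⟩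
  · rw [memLp_two_iff_lintegral (by fun_prop)]
    simp only [key]
    exact (le_self_add.trans_lt hlt).trans ENNReal.one_lt_top
  · have hc : Measurable fun x => (Real.sqrt (g (φ x)) : ℂ) :=
      Complex.measurable_ofReal.comp (hs.comp hφ)
    rw [memLp_two_iff_lintegral hc.aestronglyMeasurable]
    simp only [key]
    exact (le_add_self.trans_lt hlt).trans ENNReal.one_lt_top

/-- Approximants `w·(q n∘φ)` converge a.e. along a subsequence. Dividing by `w` shows that `q (ns
n)` converges at `φ x` for a.e. `x`, so its pointwise limit serves as `t`. -/
lemma exists_div_eq_comp_of_mem_closure_range {α : ℝ} (hφ : Measurable φ) (hw : Measurable w)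
    (h : WellDefined μ φ w) (hα : 0 < α) (hαw : ∀ᵐ x ∂μ, α < ‖w x‖) {v : Lp ℂ 2 μ}
    (hv : v ∈ (PartialOp.range (op μ φ w hφ hw h)).topologicalClosure) :
    ∃ t : X → ℂ, Measurable t ∧ ∀ᵐ x ∂μ, v x / w x = t (φ x) := by
  obtain ⟨s, hs, hlim⟩ := mem_closure_iff_seq_limit.1 hv
  choose q hq using fun n => (mem_range_op_iff hφ hw h).1 (hs n)
  obtain ⟨ns, -, hns⟩ := (tendstoInMeasure_of_tendsto_Lp hlim).exists_seq_tendsto_ae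
  refine ⟨fun y => Filter.limUnder Filter.atTop fun n => q (ns n) y,
    (StronglyMeasurable.limUnder fun n => Lp.stronglyMeasurable (q (ns n))).measurable, ?_⟩
  filter_upwards [hns, ae_all_iff.2 hq, hαw] with x e1 e2 e3
  have hw0 : w x ≠ 0 := norm_pos_iff.1 (hα.trans e3)
  refine (Filter.Tendsto.limUnder_eq ((e1.div_const (w x)).congr fun n => ?_)).symm
  rw [e2, mul_div_cancel_left₀ _ hw0]

lemma eq_condE_of_reciprocal_op_eq [SigmaFinite μ] {α : ℝ} (hφ : Measurable φ) (hw : Measurable w)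
    (h : WellDefined μ φ w) (h1 : WellDefined μ φ 1) (hα : 0 < α) (hαw : ∀ᵐ x ∂μ, α < ‖w x‖)
    [SigmaFinite (μ.map φ)]
    (heq : PartialOp.reciprocal (op μ φ w hφ hw h) =
      PartialOp.mul (PartialOp.reciprocal (compOp μ φ hφ h1))
        (PartialOp.reciprocal (mulOp μ w hw))) :
    ∀ᵐ x ∂μ, ‖w x‖ₑ ^ 2 = condE μ φ (fun y => ‖w y‖ₑ ^ 2) x := by
  have hq := h1.quasiMeasurePreserving hφ
  obtain ⟨f, hf, hf0, hfL, hfφL⟩ := exists_pos_memLp_comp (μ := μ) hφ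
  obtain ⟨g, hg⟩ : ∃ g : Lp ℂ 2 μ, g =ᵐ[μ] fun x => (f x : ℂ) := ⟨_, hfL.coeFn_toLp⟩
  obtain ⟨p, hp⟩ : ∃ p : Lp ℂ 2 μ, p =ᵐ[μ] fun x => (f (φ x) : ℂ) := ⟨_, hfφL.coeFn_toLp⟩
  -- `v = p/w̄`, chosen so that `⟨v, w·z⟩ = ⟨p, z⟩`.
  obtain ⟨v, hv⟩ := exists_coeFn_ae_eq_div (w := fun x => (starRingEnd ℂ) (w x))
    (Complex.continuous_conj.measurable.comp hw) hα (by simpa using hαw) p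
  have hvr : v ∈ (PartialOp.range (op μ φ w hφ hw h)).topologicalClosure := by
    rw [← Submodule.orthogonal_orthogonal_eq_closure, Submodule.mem_orthogonal]
    intro k hk
    obtain ⟨z, hz⟩ := exists_coeFn_ae_eq_div hw hα hαw k
    have hzr := div_mem_orthogonal_range_of_eq hφ hw h h1 hα hαw heq hk hz
    rw [Submodule.mem_orthogonal'] at hzr
    rw [← hzr p ((mem_range_compOp_iff hφ h1).2 ⟨g, hp.trans (hq.ae_eq_comp hg).symm⟩)]
    apply inner_congr
    filter_upwards [hz, hv] with x e1 e2
    rw [e1, e2]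
    simp only [RCLike.inner_apply, map_mul]
    ring
  obtain ⟨t, ht, hvt⟩ := exists_div_eq_comp_of_mem_closure_range hφ hw h hα hαw hvr
  -- From `p = w̄·v` and `v/w = t∘φ` follows `|w|² = p/(v/w) = (f/t)∘φ`; positivity of `f` ensures
  -- `v ≠ 0`.
  refine eq_condE_of_ae_eq hφ (g := fun x => ‖(f (φ x) : ℂ) / t (φ x)‖ₑ) ?_ ?_
  · have hft : Measurable fun y => ‖(f y : ℂ) / t y‖ₑ := by fun_prop
    exact hft.comp (comap_measurable φ)
  · filter_upwards [hp, hv, hvt, hαw] with x e1 e2 e3 e4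
    have hw0 : w x ≠ 0 := norm_pos_iff.1 (hα.trans e4)
    have hv0 : v x ≠ 0 := by
      intro h0
      rw [h0, mul_zero, e1] at e2
      exact (hf0 (φ x)).ne' (by exact_mod_cast e2)
    rw [← e3, ← e1, e2, mul_div_assoc, div_div_cancel₀ hv0, enorm_mul, sq]
    congr 1
    exact enorm_eq_iff_norm_eq.2 (RCLike.norm_conj _).symm

end WeightedComp

theorem proposition21 {X : Type*} [MeasurableSpace X] (μ : Measure X) [SigmaFinite μ]
    (φ : X → X) (hφ : Measurable φ) (w : X → ℂ) (hw : Measurable w)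
    (hwd : WeightedComp.WellDefined μ φ w)
    (hdense : Dense ((WeightedComp.op μ φ w hφ hw hwd).domain : Set (Lp ℂ 2 μ)))
    (α : ℝ) (hα : 0 < α) (hαw : ∀ᵐ x ∂μ, α < ‖w x‖) :
    ∃ h1 : WeightedComp.WellDefined μ φ 1,
      Dense ((WeightedComp.compOp μ φ hφ h1).domain : Set (Lp ℂ 2 μ)) ∧
      WeightedComp.op μ φ w hφ hw hwd =
        PartialOp.mul (WeightedComp.mulOp μ w hw) (WeightedComp.compOp μ φ hφ h1) ∧
      PartialOp.HasReciprocal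
        (PartialOp.mul (WeightedComp.mulOp μ w hw) (WeightedComp.compOp μ φ hφ h1)) ∧
      PartialOp.HasReciprocal (WeightedComp.compOp μ φ hφ h1) ∧
      PartialOp.HasReciprocal (WeightedComp.mulOp μ w hw) ∧
      (PartialOp.reciprocal
          (PartialOp.mul (WeightedComp.mulOp μ w hw) (WeightedComp.compOp μ φ hφ h1)) =
        PartialOp.mul (PartialOp.reciprocal (WeightedComp.compOp μ φ hφ h1))
          (PartialOp.reciprocal (WeightedComp.mulOp μ w hw)) ↔
        (∃ β : ℝ, 0 < β ∧ ∀ᵐ x ∂μ,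
          WeightedComp.rn μ φ (WeightedComp.hat μ φ w) x ≤
            ENNReal.ofReal β * WeightedComp.rn μ φ (WeightedComp.hat μ φ 1) x) ∧
        ∀ᵐ x ∂μ, ‖w x‖ₑ ^ 2 = WeightedComp.condE μ φ (fun y => ‖w y‖ₑ ^ 2) x) := by
  have hw0 : ∀ᵐ x ∂μ, w x ≠ 0 := hαw.mono fun x hx => norm_pos_iff.1 (hα.trans hx)
  have h1 : WeightedComp.WellDefined μ φ 1 := hwd.one hφ hw hw0
  have hmul := WeightedComp.op_eq_mul hφ hw hwd h1 hα hαw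
  have hd1 := WeightedComp.dense_domain_compOp hφ hw hwd h1 hα hαw hdense
  refine ⟨h1, hd1, hmul, ?_, WeightedComp.hasReciprocal_op _ _ _,
    WeightedComp.hasReciprocal_op _ _ _, ?_⟩
  · rw [← hmul]
    exact WeightedComp.hasReciprocal_op _ _ _
  rw [← hmul]
  constructor
  · intro heq
    have := WeightedComp.sigmaFinite_map h1
      (WeightedComp.rn_lt_top_of_dense hφ measurable_one h1 hd1)
    exact ⟨⟨α⁻¹ ^ 2, by positivity, WeightedComp.rn_hat_le hφ hw hwd h1
      (WeightedComp.rn_lt_top_of_dense hφ hw hwd hdense) hα hαw⟩,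
      WeightedComp.eq_condE_of_reciprocal_op_eq hφ hw hwd h1 hα hαw heq⟩
  · rintro ⟨-, hE⟩
    obtain ⟨u, hu, hαu, hwu⟩ := WeightedComp.exists_comp_eq_of_eq_condE hα hαw hE
    exact WeightedComp.reciprocal_op_eq_of_factor hφ hw hwd h1 hα hαw hu hαu hwu
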